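/- Let $N\ge 1$. Let $L_0[u]=\tfrac12$, $L_1[u],L_2[u],\dots$ be the differential polynomials in $u$ determined by the Lenard recursion $\frac{d}{dz}L_{k+1}[u]=\left(\frac{d^3}{dz^3}+4u\frac{d}{dz}+2u_z\right)L_k[u]$, where $L_{k+1}$ has no constant term, and let $$P_2^{(N)}[w,\alpha]=\left(\frac{d}{dz}+2w\right)L_N[w'-w^2]-zw-\alpha=0$$ be the $N$-th equation of the second Painlevé hierarchy. Let $Q_0^{(N)}=1$ and, for $n\ge1$, let $Q_n^{(N)}\in\mathbb C[z]$ be a monic polynomial such that $w=\frac{d}{dz}\ln\bigl(Q_{n-1}^{(N)}/Q_n^{(N)}\bigr)$ is a rational solution of $P_2^{(N)}[w,n]=0$. Put $p_n=n(n+1)/2$. (1) For every $\alpha\in\mathbb C$ there is exactly one formal series $w=\sum_{m\ge0}c_{\alpha,-(m+1)}z^{-m-1}$ satisfying $P_2^{(N)}[w,\alpha]=0$; moreover $c_{\alpha,-1}=-\alpha$ and $c_{\alpha,-(m+1)}=0$ unless $(2N+1)\mid m$. (2) Let $n\ge0$ be such that $Q_0^{(N)},\dots,Q_n^{(N)}$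 exist. Then $Q_n^{(N)}$ is unique, $\deg Q_n^{(N)}=p_n=-\sum_{i=1}^n c_{i,-1}$, and for every $m\ge1$ the sum $s_{n,m}$ of the $m$-th powers of the roots of $Q_n^{(N)}$, counted with multiplicity, is $s_{n,m}=-\sum_{i=2}^n c_{i,-(m+1)}$. Write $Q_n^{(N)}(z)=\sum_{m=0}^{p_n}A_{n,m}z^{p_n-m}$. Then all the coefficients $A_{n,m}$ are determined by the first $p_n+1$ coefficients $c_{i,-(m+1)}$, $0\le m\le p_n$, of the expansions with $\alpha=i$, $1\le i\le n$: the numbers $A_{n,0},\dots,A_{n,p_n}$ are the unique solution of Newton's identities $$A_{n,0}=1,\qquad mA_{n,m}+\sum_{j=1}^m s_{n,j}A_{n,m-j}=0\quad(1\le m\le p_n),\qquad s_{n,j}=-\sum_{i=2}^n c_{i,-(j+1)}.$$ (3) For such $n$, $A_{n,m}=0$ for all $0\le m\le p_n$ with $(2N+1)\nmid m$. Hence $Q_n^{(N)}(z)=z^r q(z^{2N+1})$ with $r=p_n \bmod (2N+1)$ and a polynomial $q$ of degree $\lfloor n(n+1)/(4N+2)\rfloor$. In particular, if $n\equiv 0$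 or $n\equiv 2N \pmod{2N+1}$, then $(2N+1)\mid p_n$, so that $r=0$ and $Q_n^{(N)}$ is a polynomial in $z^{2N+1}$. -/

import Mathlib

noncomputable section

open Polynomial

namespace PainleveTwo

/-- Differential polynomials over `ℂ` in one dependent variable `u`: the variable `X j` stands for
the `j`-th derivative of `u`. -/
abbrev DiffPoly : Type := MvPolynomial ℕ ℂ

/-- The total derivative `d/dz` on differential polynomials: `u_j ↦ u_{j+1}`. -/
def dz : Derivation ℂ DiffPoly DiffPoly :=
  MvPolynomial.mkDerivation ℂ (fun j => MvPolynomial.X (j + 1))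

/-- `u` and `u_z` as differential polynomials. -/
abbrev u₀ : DiffPoly := MvPolynomial.X 0

abbrev u₁ : DiffPoly := MvPolynomial.X 1

/-- The Lenard recursion `d_z L_{N+1} = (d_z³ + 4 u d_z + 2 u_z) L_N`, `L_0 = 1/2`, with vanishing
integration constants. -/
structure IsLenard (L : ℕ → DiffPoly) : Prop where
  zero : L 0 = MvPolynomial.C (1 / 2)
  succ : ∀ N, dz (L (N + 1)) = dz (dz (dz (L N))) + 4 * u₀ * dz (L N) + 2 * u₁ * L N
  const : ∀ N, MvPolynomial.constantCoeff (L (N + 1)) = 0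

/-! ### The Lenard recursion has exactly one solution -/

/-- Explicit solution of the Lenard recursion (its quadratic first integral). -/
def lenardAux : ℕ → DiffPoly
  | 0 => MvPolynomial.C (1 / 2)
  | N + 1 =>
    (∑ i : Fin (N + 1), (2 * lenardAux i * dz (dz (lenardAux (N - i)))
        - dz (lenardAux i) * dz (lenardAux (N - i)) + 4 * u₀ * lenardAux i * lenardAux (N - i)))
      - ∑ i : Fin N, lenardAux (i + 1) * lenardAux (N - i)
  decreasing_by all_goals omega

theorem constantCoeff_dz (P : DiffPoly) : MvPolynomial.constantCoeff (dz P) = 0 := by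
  induction P using MvPolynomial.induction_on with
  | C a => simp [dz]
  | add p q hp hq => simp [hp, hq]
  | mul_X p n hp => simp [dz] at hp ⊢

theorem constantCoeff_lenardAux (N : ℕ) :
    MvPolynomial.constantCoeff (lenardAux (N + 1)) = 0 := by
  induction N using Nat.strong_induction_on with
  | _ N ih =>
    rw [lenardAux]
    simp only [map_sub, map_sum, map_add, map_mul, constantCoeff_dz]
    have : ∀ i : Fin N, MvPolynomial.constantCoeff (lenardAux (i + 1)) = 0 := fun i => ih i i.2
    simp [this]

theorem lenardAux_quadratic (N : ℕ) :
    ∑ p ∈ Finset.HasAntidiagonal.antidiagonal (N + 1), lenardAux p.1 * lenardAux p.2 =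
      ∑ p ∈ Finset.HasAntidiagonal.antidiagonal N, (2 * lenardAux p.1 * dz (dz (lenardAux p.2))
        - dz (lenardAux p.1) * dz (lenardAux p.2)
        + 4 * u₀ * lenardAux p.1 * lenardAux p.2) := by
  rw [Finset.Nat.sum_antidiagonal_eq_sum_range_succ_mk,
    Finset.Nat.sum_antidiagonal_eq_sum_range_succ_mk, Finset.sum_range_succ,
    Finset.sum_range_succ']
  have h0 : lenardAux 0 = MvPolynomial.C (1 / 2) := by rw [lenardAux]
  have h2 : (MvPolynomial.C (1 / 2) : DiffPoly) + MvPolynomial.C (1 / 2) = 1 := by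
    rw [← map_add]; norm_num
  have h := lenardAux.eq_2 N
  rw [← Fin.sum_univ_eq_sum_range (fun i => 2 * lenardAux i * dz (dz (lenardAux (N - i)))
        - dz (lenardAux i) * dz (lenardAux (N - i)) + 4 * u₀ * lenardAux i * lenardAux (N - i)),
    ← Fin.sum_univ_eq_sum_range (fun i => lenardAux (i + 1) * lenardAux (N + 1 - (i + 1)))]
  simp only [Nat.add_sub_add_right, Nat.sub_zero, Nat.sub_self, h0]
  linear_combination h + lenardAux (N + 1) * h2

theorem lenardAux_succ (N : ℕ) :
    dz (lenardAux (N + 1)) = dz (dz (dz (lenardAux N))) + 4 * u₀ * dz (lenardAux N)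
      + 2 * u₁ * lenardAux N := by
  set E : ℕ → DiffPoly := fun N => dz (lenardAux (N + 1)) - (dz (dz (dz (lenardAux N)))
    + 4 * u₀ * dz (lenardAux N) + 2 * u₁ * lenardAux N) with hE
  have hu : dz u₀ = u₁ := by simp [dz]
  have hL0 : dz (lenardAux 0) = 0 := by rw [lenardAux]; simp [dz]
  have sw : ∀ (F : ℕ → ℕ → DiffPoly) (n : ℕ),
      ∑ p ∈ Finset.HasAntidiagonal.antidiagonal n, F p.1 p.2 = ∑ p ∈ Finset.HasAntidiagonal.antidiagonal n, F p.2 p.1 :=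
    fun F n => (Finset.Nat.sum_antidiagonal_swap (f := fun p => F p.1 p.2)).symm
  have key : ∀ n, ∑ p ∈ Finset.HasAntidiagonal.antidiagonal n, lenardAux p.1 * E p.2 = 0 := by
    intro n
    have h := congrArg dz (lenardAux_quadratic n)
    simp only [map_sum, map_add, map_sub, Derivation.leibniz, smul_eq_mul] at h
    have e2 : dz (2 : DiffPoly) = 0 := by
      simpa using Derivation.map_natCast dz 2
    have e4 : dz (4 : DiffPoly) = 0 := by
      simpa using Derivation.map_natCast dz 4
    simp only [e2, e4, hu, mul_zero, add_zero, Finset.sum_add_distrib, Finset.sum_sub_distrib] at h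
    rw [sw (fun i j => lenardAux j * dz (lenardAux i)) (n + 1),
      Finset.Nat.sum_antidiagonal_succ'] at h
    simp only [hL0, mul_zero] at h
    have s1 := sw (fun i j => dz (dz (lenardAux j)) * dz (lenardAux i)) n
    have s2 := sw (fun i j => lenardAux j * (4 * u₀ * dz (lenardAux i))) n
    have hEsum : ∑ p ∈ Finset.HasAntidiagonal.antidiagonal n, lenardAux p.1 * E p.2 =
        ∑ p ∈ Finset.HasAntidiagonal.antidiagonal n, lenardAux p.1 * dz (lenardAux (p.2 + 1))
        - ∑ p ∈ Finset.HasAntidiagonal.antidiagonal n, lenardAux p.1 * dz (dz (dz (lenardAux p.2)))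
        - ∑ p ∈ Finset.HasAntidiagonal.antidiagonal n, lenardAux p.1 * (4 * u₀ * dz (lenardAux p.2))
        - ∑ p ∈ Finset.HasAntidiagonal.antidiagonal n, lenardAux p.1 * (2 * u₁ * lenardAux p.2) := by
      simp only [hE, ← Finset.sum_sub_distrib]
      exact Finset.sum_congr rfl fun p _ => by ring
    have t1 : ∑ p ∈ Finset.HasAntidiagonal.antidiagonal n, 2 * lenardAux p.1 * dz (dz (dz (lenardAux p.2))) =
        2 * ∑ p ∈ Finset.HasAntidiagonal.antidiagonal n, lenardAux p.1 * dz (dz (dz (lenardAux p.2))) := by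
      rw [Finset.mul_sum]; exact Finset.sum_congr rfl fun p _ => by ring
    have t2 : ∑ p ∈ Finset.HasAntidiagonal.antidiagonal n, dz (dz (lenardAux p.2)) * (2 * dz (lenardAux p.1)) =
        2 * ∑ p ∈ Finset.HasAntidiagonal.antidiagonal n, dz (dz (lenardAux p.2)) * dz (lenardAux p.1) := by
      rw [Finset.mul_sum]; exact Finset.sum_congr rfl fun p _ => by ring
    have t3 : ∑ p ∈ Finset.HasAntidiagonal.antidiagonal n, dz (lenardAux p.1) * dz (dz (lenardAux p.2)) =
        ∑ p ∈ Finset.HasAntidiagonal.antidiagonal n, dz (dz (lenardAux p.2)) * dz (lenardAux p.1) :=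
      Finset.sum_congr rfl fun p _ => by ring
    have t4 : ∑ p ∈ Finset.HasAntidiagonal.antidiagonal n, dz (lenardAux p.2) * dz (dz (lenardAux p.1)) =
        ∑ p ∈ Finset.HasAntidiagonal.antidiagonal n, dz (dz (lenardAux p.1)) * dz (lenardAux p.2) :=
      Finset.sum_congr rfl fun p _ => by ring
    have t5 : ∑ p ∈ Finset.HasAntidiagonal.antidiagonal n, 4 * u₀ * lenardAux p.1 * dz (lenardAux p.2) =
        ∑ p ∈ Finset.HasAntidiagonal.antidiagonal n, lenardAux p.1 * (4 * u₀ * dz (lenardAux p.2)) :=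
      Finset.sum_congr rfl fun p _ => by ring
    have t6 : ∑ p ∈ Finset.HasAntidiagonal.antidiagonal n, lenardAux p.2 * (4 * u₀ * dz (lenardAux p.1) + lenardAux p.1 * (4 * u₁)) =
        ∑ p ∈ Finset.HasAntidiagonal.antidiagonal n, lenardAux p.2 * (4 * u₀ * dz (lenardAux p.1))
        + 2 * ∑ p ∈ Finset.HasAntidiagonal.antidiagonal n, lenardAux p.1 * (2 * u₁ * lenardAux p.2) := by
      rw [Finset.mul_sum, ← Finset.sum_add_distrib]
      exact Finset.sum_congr rfl fun p _ => by ring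
    refine (mul_eq_zero.mp ?_).resolve_left (two_ne_zero (α := DiffPoly))
    linear_combination 2 * hEsum + h + t1 + t2 - t3 - t4 + t5 + t6 + s1 + s2
  have hz : ∀ n, E n = 0 := by
    intro n
    induction n using Nat.strong_induction_on with
    | _ n ih =>
      have h := key n
      rw [Finset.sum_eq_single (0, n)] at h
      · have h0 : lenardAux 0 ≠ 0 := by rw [lenardAux]; simp
        exact (mul_eq_zero.mp h).resolve_left h0
      · rintro ⟨i, j⟩ hij hne
        rw [Finset.HasAntidiagonal.mem_antidiagonal] at hij
        simp only at hij
        have : i ≠ 0 := by rintro rfl; apply hne; simp at hij; simp [hij]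
        simp [ih j (by omega)]
      · simp
  exact sub_eq_zero.mp (hz N)

theorem isLenard_lenardAux : IsLenard lenardAux :=
  ⟨by rw [lenardAux], lenardAux_succ, constantCoeff_lenardAux⟩

/-- The only differential polynomials with zero total derivative are the constants. -/
theorem eq_C_of_dz_eq_zero (P : DiffPoly) (h : dz P = 0) :
    P = MvPolynomial.C (MvPolynomial.constantCoeff P) := by
  have comm : ∀ (k : ℕ) (Q : DiffPoly), MvPolynomial.pderiv (k + 1) (dz Q) =
      dz (MvPolynomial.pderiv (k + 1) Q) + MvPolynomial.pderiv k Q := by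
    intro k Q
    induction Q using MvPolynomial.induction_on with
    | C a => simp [dz]
    | add p q hp hq => simp only [map_add, hp, hq]; ring
    | mul_X p n hp =>
      have hX : MvPolynomial.pderiv (k + 1) (dz (MvPolynomial.X n)) =
          MvPolynomial.pderiv k (MvPolynomial.X n : DiffPoly) := by
        by_cases hkn : n = k
        · subst hkn; simp [dz]
        · simp [dz, MvPolynomial.pderiv_X_of_ne hkn,
            MvPolynomial.pderiv_X_of_ne (show n + 1 ≠ k + 1 by omega)]
      have hX' : dz (MvPolynomial.pderiv (k + 1) (MvPolynomial.X n : DiffPoly)) = 0 := by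
        by_cases hkn : n = k + 1
        · subst hkn; simp
        · simp [MvPolynomial.pderiv_X_of_ne hkn]
      simp only [Derivation.leibniz, smul_eq_mul, map_add, hp, hX, hX']
      ring
  have hp : ∀ k, MvPolynomial.pderiv k P = 0 := by
    obtain ⟨K, hK⟩ : ∃ K, ∀ k, K ≤ k → MvPolynomial.pderiv k P = 0 := by
      refine ⟨P.vars.sup id + 1, fun k hk => MvPolynomial.pderiv_eq_zero_of_notMem_vars ?_⟩
      intro hmem
      have : k ≤ P.vars.sup id := Finset.le_sup (f := id) hmem
      omega
    have down : ∀ d k, K ≤ k + d → MvPolynomial.pderiv k P = 0 := by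
      intro d
      induction d with
      | zero => exact fun k hk => hK k hk
      | succ d ih =>
        intro k hk
        have := comm k P
        rw [h, ih (k + 1) (by omega)] at this
        simpa using this.symm
    exact fun k => down K k (by omega)
  ext m
  rw [MvPolynomial.coeff_C]
  split_ifs with hm
  · subst hm; rfl
  · obtain ⟨k, hk⟩ : ∃ k, m k ≠ 0 := by
      by_contra hcon
      push Not at hcon
      exact hm (Finsupp.ext fun k => (hcon k).symm)
    have h1 := MvPolynomial.coeff_pderiv (i := k) P (m - Finsupp.single k 1)
    have h2 : m - Finsupp.single k 1 + Finsupp.single k 1 = m :=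
      tsub_add_cancel_of_le (by simpa [Finsupp.single_le_iff] using Nat.one_le_iff_ne_zero.mpr hk)
    rw [hp k, h2] at h1
    have h3 : ((m - Finsupp.single k 1 : ℕ →₀ ℕ) k : ℂ) + 1 ≠ 0 := Nat.cast_add_one_ne_zero _
    exact (mul_eq_zero.mp h1.symm).resolve_right h3

theorem existsUnique_isLenard : ∃! L : ℕ → DiffPoly, IsLenard L := by
  refine ⟨lenardAux, isLenard_lenardAux, fun L hL => ?_⟩
  funext N
  induction N with
  | zero => rw [hL.zero, isLenard_lenardAux.zero]
  | succ N ih =>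
    have h := eq_C_of_dz_eq_zero (L (N + 1) - lenardAux (N + 1)) (by
      rw [map_sub, hL.succ, isLenard_lenardAux.succ, ih, sub_self])
    rw [map_sub, hL.const, isLenard_lenardAux.const] at h
    simpa [sub_eq_zero] using h

/-- The differential polynomials `L_N[u]` given by the Lenard recursion. -/
def lenard : ℕ → DiffPoly := existsUnique_isLenard.choose

theorem isLenard_lenard : IsLenard lenard := existsUnique_isLenard.choose_spec.1

/-! ### The second Painlevé hierarchy -/

/-- The value of `L_N[u]` at an element `u` of a `ℂ`-algebra with differentiation `D`. -/
def lenardEval {A : Type*} [CommRing A] [Algebra ℂ A] (D : A → A) (N : ℕ) (u : A) : A :=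
  MvPolynomial.aeval (fun j => D^[j] u) (lenard N)

/-- The left-hand side `P₂^{(N)}[w, α] = (d/dz + 2w) L_N[w' - w²] - z w - α` of the `N`-th equation
of the second Painlevé hierarchy, in a `ℂ`-algebra with differentiation `D` and
independent variable `z`. -/
def P2 {A : Type*} [CommRing A] [Algebra ℂ A] (D : A → A) (z : A) (N : ℕ) (w : A) (α : ℂ) : A :=
  D (lenardEval D N (D w - w ^ 2)) + 2 * w * lenardEval D N (D w - w ^ 2) - z * w
    - algebraMap ℂ A α

/-- The derivative `d/dz` of a rational function of `z` (quotient rule). -/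
def ratDeriv (f : RatFunc ℂ) : RatFunc ℂ :=
  algebraMap ℂ[X] (RatFunc ℂ) (derivative f.num * f.denom - f.num * derivative f.denom) /
    algebraMap ℂ[X] (RatFunc ℂ) (f.denom ^ 2)

/-- The rational function `w` solves `P₂^{(N)}[w, α] = 0`. -/
def IsRationalSolution (N : ℕ) (α : ℂ) (w : RatFunc ℂ) : Prop :=
  P2 ratDeriv RatFunc.X N w α = 0

/-- The logarithmic derivative `Q'/Q` of a polynomial. -/
def polyLogDeriv (Q : ℂ[X]) : RatFunc ℂ :=
  algebraMap ℂ[X] (RatFunc ℂ) (derivative Q) / algebraMap ℂ[X] (RatFunc ℂ) Q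

/-- `IsYablonskiiVorobev N n Q`: the polynomial `Q` is `Q_n^{(N)}`. Here `Q_0 = 1`, and `Q_{n+1}` is
the monic polynomial for which `w = d/dz ln (Q_n / Q_{n+1})` is a rational solution of
`P₂^{(N)}[w, n + 1] = 0`. -/
inductive IsYablonskiiVorobev (N : ℕ) : ℕ → ℂ[X] → Prop
  | zero : IsYablonskiiVorobev N 0 1
  | succ {n : ℕ} {P Q : ℂ[X]} : IsYablonskiiVorobev N n P → Q.Monic →
      IsRationalSolution N ((n + 1 : ℕ) : ℂ) (polyLogDeriv P - polyLogDeriv Q) →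
      IsYablonskiiVorobev N (n + 1) Q

/-! ### Expansions at infinity: Laurent series in `t = 1/z` -/

/-- The derivative `d/dz = -t² d/dt` on Laurent series in `t = 1/z`. -/
def dInf (f : LaurentSeries ℂ) : LaurentSeries ℂ :=
  -(HahnSeries.single (2 : ℤ) (1 : ℂ) * LaurentSeries.derivative ℂ f)

/-- The variable `z = t⁻¹` as a Laurent series in `t = 1/z`. -/
def zInf : LaurentSeries ℂ := HahnSeries.single (-1 : ℤ) (1 : ℂ)

/-- The series `∑_{m ≥ 0} c_m z^{-m-1}`, as a Laurent series in `t = 1/z`. -/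
def seriesAtInfinity (c : ℕ → ℂ) : LaurentSeries ℂ :=
  HahnSeries.single (1 : ℤ) (1 : ℂ) * HahnSeries.ofPowerSeries ℤ ℂ (PowerSeries.mk c)

/-- The series `∑_{m ≥ 0} c_m z^{-m-1}` satisfies `P₂^{(N)}[w, α] = 0`; thus `c m` is the
coefficient of `z^{-(m+1)}`. -/
def IsExpansionAtInfinity (N : ℕ) (α : ℂ) (c : ℕ → ℂ) : Prop :=
  P2 dInf zInf N (seriesAtInfinity c) α = 0

end PainleveTwo

end

/-!
Give `u^{(j)}` weight `j + 2`: the Lenard recursion makes `L_N` homogeneous of weight `2N`. For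
`w = ∑ c_m t^{m+1}` with `t = 1/z`, the nonlinear part `(d/dz + 2w) L_N[w' - w²]` therefore starts
at `t^{2N+1}`, and its coefficient of `t^m` involves only `c_i` with `i < m`. As `z w` contributes
`c_m` to that coefficient, `P₂^{(N)}[w, α] = 0` is a recursion for `c`, which has exactly one
solution. If `c` is supported on the multiples of `2N + 1`, then so are the exponents of the
nonlinear part; hence the recursion preserves this sparsity.

The coefficients of `Q'/Q` at infinity are the power sums of the roots of `Q`. The expansion of
`Q_{i-1}'/Q_{i-1} - Q_i'/Q_i` is the one with `α = i`, so the power sums of the roots of `Q_n`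
telescope to `-∑ c_{i, -(m+1)}`; the term `i = 1` is the expansion of the solution `-1/z` and only
contributes to `m = 0`. Newton's identities carry uniqueness and sparsity from the power sums over
to the coefficients of `Q_n`.
-/

namespace PainleveTwo

/-! ### Weights -/

section Weight

open MvPolynomial

theorem isWeightedHomogeneous_mkDerivation {R σ M : Type*} [CommSemiring R] [AddCommMonoid M]
    {w : σ → M} {k n : M} {f : σ → MvPolynomial σ R} {p : MvPolynomial σ R}
    (hf : ∀ i, (f i).IsWeightedHomogeneous w (w i + k)) (hp : p.IsWeightedHomogeneous w n) :
    (mkDerivation R f p).IsWeightedHomogeneous w (n + k) := by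
  induction hp using IsWeightedHomogeneous.induction_on with
  | zero => simpa only [map_zero] using isWeightedHomogeneous_zero R w (n + k)
  | add p q _ _ hp hq => simpa only [map_add] using hp.add hq
  | monomial d r hd =>
    rw [mkDerivation_monomial, smul_eq_C_mul, ← zero_add (n + k)]
    refine (isWeightedHomogeneous_C w r).mul (.sum _ _ _ fun i hi => ?_)
    have hweight : Finsupp.weight w (d - Finsupp.single i 1) + (w i + k) = n + k := by
      rw [← add_assoc, Finsupp.weight_sub_single_add (Finsupp.mem_support_iff.mp hi), hd]
    exact hweight ▸ (isWeightedHomogeneous_monomial w _ _ rfl).mul (hf i)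

theorem aeval_mem_graded {R σ M A S : Type*} [CommSemiring R] [AddCommMonoid M] [CommSemiring A]
    [Algebra R A] [SetLike S A] [AddSubmonoidClass S A] (𝒜 : M → S) [SetLike.GradedMonoid 𝒜]
    (hC : ∀ r, algebraMap R A r ∈ 𝒜 0) {w : σ → M} {n : M} {f : σ → A} {p : MvPolynomial σ R}
    (hf : ∀ i, f i ∈ 𝒜 (w i)) (hp : p.IsWeightedHomogeneous w n) : aeval f p ∈ 𝒜 n := by
  rw [aeval_def, eval₂_eq]
  refine sum_mem fun d hd => ?_
  rw [← hp (mem_support_iff.mp hd), Finsupp.weight_apply, ← zero_add (d.sum _)]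
  exact SetLike.mul_mem_graded (hC _) (SetLike.prod_pow_mem_graded 𝒜 w f d fun i _ => hf i)

theorem isWeightedHomogeneous_dz {n : ℕ} {p : DiffPoly}
    (hp : p.IsWeightedHomogeneous (fun j : ℕ => j + 2) n) :
    (dz p).IsWeightedHomogeneous (fun j : ℕ => j + 2) (n + 1) :=
  isWeightedHomogeneous_mkDerivation
    (fun i => add_right_comm i 1 2 ▸ isWeightedHomogeneous_X ℂ _ (i + 1)) hp

theorem lenard_eq_lenardAux : lenard = lenardAux :=
  existsUnique_isLenard.unique isLenard_lenard isLenard_lenardAux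

theorem isWeightedHomogeneous_lenard (N : ℕ) :
    (lenard N).IsWeightedHomogeneous (fun j : ℕ => j + 2) (2 * N) := by
  rw [lenard_eq_lenardAux]
  induction N using Nat.strong_induction_on with
  | _ N ih =>
    have natCast (k : ℕ) [k.AtLeastTwo] :
        (ofNat(k) : DiffPoly).IsWeightedHomogeneous (fun j : ℕ => j + 2) 0 :=
      map_ofNat (C : ℂ →+* DiffPoly) k ▸ isWeightedHomogeneous_C _ _
    cases N with
    | zero => rw [lenardAux]; exact isWeightedHomogeneous_C _ _
    | succ N =>
      rw [lenardAux]
      refine .sub (.sum _ _ _ fun i _ => .add (.sub ?_ ?_) ?_) (.sum _ _ _ fun i _ => ?_)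
      all_goals have hi := i.2
      · have hweight : 0 + 2 * (i : ℕ) + (2 * (N - i) + 1 + 1) = 2 * (N + 1) := by omega
        exact hweight ▸ ((natCast 2).mul (ih i (by omega))).mul
          (isWeightedHomogeneous_dz (isWeightedHomogeneous_dz (ih (N - i) (by omega))))
      · have hweight : 2 * (i : ℕ) + 1 + (2 * (N - i) + 1) = 2 * (N + 1) := by omega
        exact hweight ▸ (isWeightedHomogeneous_dz (ih i (by omega))).mul
          (isWeightedHomogeneous_dz (ih (N - i) (by omega)))
      · have hweight : 0 + (0 + 2) + 2 * (i : ℕ) + 2 * (N - i) = 2 * (N + 1) := by omega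
        exact hweight ▸ (((natCast 4).mul (isWeightedHomogeneous_X ℂ _ 0)).mul
          (ih i (by omega))).mul (ih (N - i) (by omega))
      · have hweight : 2 * ((i : ℕ) + 1) + 2 * (N - i) = 2 * (N + 1) := by omega
        exact hweight ▸ (ih (i + 1) (by omega)).mul (ih (N - i) (by omega))

end Weight

section CongruentPairs

variable {A : Type*} [CommRing A]

/-- The pairs of elements of `F i` that agree modulo `F (i + K)`. They form a graded family in
`A × A`, so that a weight estimate in `A × A` becomes a continuity estimate in `A`. -/
def congruentPairs (F : ℕ → AddSubgroup A) (K i : ℕ) : AddSubgroup (A × A) :=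
  (F i).prod (F i) ⊓ (F (i + K)).comap (AddMonoidHom.fst A A - AddMonoidHom.snd A A)

theorem mem_congruentPairs {F : ℕ → AddSubgroup A} {K i : ℕ} {p : A × A} :
    p ∈ congruentPairs F K i ↔ (p.1 ∈ F i ∧ p.2 ∈ F i) ∧ p.1 - p.2 ∈ F (i + K) :=
  Iff.rfl

instance (F : ℕ → AddSubgroup A) [SetLike.GradedMonoid F] (K : ℕ) :
    SetLike.GradedMonoid (congruentPairs F K) where
  one_mem := by
    rw [mem_congruentPairs, Prod.fst_one, Prod.snd_one, sub_self]
    exact ⟨⟨SetLike.one_mem_graded F, SetLike.one_mem_graded F⟩, zero_mem _⟩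
  mul_mem := by
    rintro i j ⟨f, f'⟩ ⟨g, g'⟩ ⟨⟨hf, hf'⟩, hff'⟩ ⟨⟨hg, hg'⟩, hgg'⟩
    have h₁ : f * (g - g') ∈ F (i + j + K) := add_assoc i j K ▸ SetLike.mul_mem_graded hf hgg'
    have h₂ : (f - f') * g' ∈ F (i + j + K) :=
      add_right_comm i K j ▸ SetLike.mul_mem_graded hff' hg'
    have h : f * g - f' * g' = f * (g - g') + (f - f') * g' := by ring
    rw [Prod.mk_mul_mk, mem_congruentPairs, h]
    exact ⟨⟨SetLike.mul_mem_graded hf hg, SetLike.mul_mem_graded hf' hg'⟩, add_mem h₁ h₂⟩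

end CongruentPairs

section Nonlinear

variable {A B : Type*} [CommRing A] [Algebra ℂ A] [CommRing B] [Algebra ℂ B]

/-- The part `(d/dz + 2w) L_N[w' - w²]` of `P₂^{(N)}[w, α]`, which involves neither `z` nor `α`. -/
noncomputable def P2Nonlinear (D : A → A) (N : ℕ) (w : A) : A :=
  D (lenardEval D N (D w - w ^ 2)) + 2 * w * lenardEval D N (D w - w ^ 2)

theorem P2_eq_P2Nonlinear_sub (D : A → A) (z : A) (N : ℕ) (w : A) (α : ℂ) :
    P2 D z N w α = P2Nonlinear D N w - z * w - algebraMap ℂ A α :=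
  rfl

theorem map_lenardEval (φ : A →ₐ[ℂ] B) {D : A → A} {D' : B → B}
    (hφ : Function.Semiconj φ D D') (N : ℕ) (u : A) :
    φ (lenardEval D N u) = lenardEval D' N (φ u) := by
  simp only [lenardEval, MvPolynomial.comp_aeval_apply, (hφ.iterate_right _).eq]

theorem map_P2Nonlinear (φ : A →ₐ[ℂ] B) {D : A → A} {D' : B → B}
    (hφ : Function.Semiconj φ D D') (N : ℕ) (w : A) :
    φ (P2Nonlinear D N w) = P2Nonlinear D' N (φ w) := by
  simp only [P2Nonlinear, map_add, map_sub, map_mul, map_pow, map_ofNat, map_lenardEval φ hφ,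
    hφ.eq]

theorem map_P2 (φ : A →ₐ[ℂ] B) {D : A → A} {D' : B → B} (hφ : Function.Semiconj φ D D')
    (z : A) (N : ℕ) (w : A) (α : ℂ) : φ (P2 D z N w α) = P2 D' (φ z) N (φ w) α := by
  simp only [P2_eq_P2Nonlinear_sub, map_sub, map_mul, map_P2Nonlinear φ hφ, AlgHom.commutes]

theorem lenardEval_zero {D : A → A} (hD : D 0 = 0) {N : ℕ} (hN : 1 ≤ N) :
    lenardEval D N 0 = 0 := by
  obtain ⟨N, rfl⟩ := Nat.exists_eq_add_of_le' hN
  have hiter (j : ℕ) : D^[j] 0 = 0 := Function.iterate_fixed hD j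
  simp only [lenardEval, hiter, MvPolynomial.aeval_zero', isLenard_lenard.const, map_zero]

theorem P2Nonlinear_eq_zero {D : A → A} (hD : D 0 = 0) {N : ℕ} (hN : 1 ≤ N) {w : A}
    (hw : D w = w ^ 2) : P2Nonlinear D N w = 0 := by
  rw [P2Nonlinear, sub_eq_zero_of_eq hw, lenardEval_zero hD hN, hD, mul_zero, add_zero]

theorem P2Nonlinear_mem_graded (F : ℕ → AddSubgroup A) [SetLike.GradedMonoid F]
    (hF : ∀ a, algebraMap ℂ A a ∈ F 0) {D : A → A} (hD : ∀ i, ∀ f ∈ F i, D f ∈ F (i + 1))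
    (N : ℕ) {w : A} (hw : w ∈ F 1) : P2Nonlinear D N w ∈ F (2 * N + 1) := by
  have hu : D w - w ^ 2 ∈ F 2 := sub_mem (hD 1 w hw) (SetLike.pow_mem_graded 2 hw)
  have hiter (j : ℕ) : D^[j] (D w - w ^ 2) ∈ F (j + 2) := by
    induction j with
    | zero => exact hu
    | succ j ih =>
      rw [Function.iterate_succ_apply', add_right_comm]
      exact hD _ _ ih
  have hL : lenardEval D N (D w - w ^ 2) ∈ F (2 * N) :=
    aeval_mem_graded F hF hiter (isWeightedHomogeneous_lenard N)
  have hwL : w * lenardEval D N (D w - w ^ 2) ∈ F (2 * N + 1) :=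
    add_comm 1 (2 * N) ▸ SetLike.mul_mem_graded hw hL
  rw [P2Nonlinear, mul_assoc, two_mul (w * _)]
  exact add_mem (hD _ _ hL) (add_mem hwL hwL)

theorem P2Nonlinear_sub_mem (F : ℕ → AddSubgroup A) [SetLike.GradedMonoid F]
    (hF : ∀ a, algebraMap ℂ A a ∈ F 0) {D : A →+ A} (hD : ∀ i, ∀ f ∈ F i, D f ∈ F (i + 1))
    (N K : ℕ) {w w' : A} (hw : w ∈ F 1) (hw' : w' ∈ F 1) (h : w - w' ∈ F (1 + K)) :
    P2Nonlinear D N w - P2Nonlinear D N w' ∈ F (2 * N + 1 + K) := by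
  have hF' (a : ℂ) : algebraMap ℂ (A × A) a ∈ congruentPairs F K 0 := by
    rw [mem_congruentPairs, Prod.algebraMap_apply, sub_self]
    exact ⟨⟨hF a, hF a⟩, zero_mem _⟩
  have hD' (i : ℕ) (p : A × A) (hp : p ∈ congruentPairs F K i) :
      Prod.map D D p ∈ congruentPairs F K (i + 1) := by
    rw [mem_congruentPairs, Prod.map_fst, Prod.map_snd, ← map_sub, add_right_comm]
    exact ⟨⟨hD i _ hp.1.1, hD i _ hp.1.2⟩, hD (i + K) _ hp.2⟩
  have hpair := P2Nonlinear_mem_graded (congruentPairs F K) hF' hD' N (w := (w, w')) ⟨⟨hw, hw'⟩, h⟩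
  have hfst := map_P2Nonlinear (AlgHom.fst ℂ A A) (D := Prod.map D D) (fun _ => rfl) N (w, w')
  have hsnd := map_P2Nonlinear (AlgHom.snd ℂ A A) (D := Prod.map D D) (fun _ => rfl) N (w, w')
  exact hfst ▸ hsnd ▸ (mem_congruentPairs.mp hpair).2

end Nonlinear

/-! ### Laurent series in `1/z` -/

section Laurent

open HahnSeries

theorem coeff_dInf (f : LaurentSeries ℂ) (k : ℤ) :
    (dInf f).coeff k = -((k - 1 : ℤ) : ℂ) * f.coeff (k - 1) := by
  have h : k - 2 + ((1 : ℕ) : ℤ) = k - 1 := by push_cast; ring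
  rw [dInf, coeff_neg, coeff_single_mul, LaurentSeries.derivative_apply,
    LaurentSeries.hasseDeriv_coeff, h, Ring.choose_one_right, zsmul_eq_mul]
  ring

theorem coeff_zInf_mul (f : LaurentSeries ℂ) (k : ℤ) :
    (zInf * f).coeff k = f.coeff (k + 1) := by
  rw [zInf, coeff_single_mul, one_mul, sub_neg_eq_add]

theorem coeff_zInf_mul_dInf (f : LaurentSeries ℂ) (k : ℤ) :
    (zInf * dInf f).coeff k = -(k : ℂ) * f.coeff k := by
  rw [coeff_zInf_mul, coeff_dInf, add_sub_cancel_right]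

theorem support_zInf_mul_dInf_subset (f : LaurentSeries ℂ) :
    (zInf * dInf f).support ⊆ f.support := by
  intro k hk
  rw [mem_support, coeff_zInf_mul_dInf] at hk
  exact right_ne_zero_of_mul hk

theorem zInf_ne_zero : zInf ≠ 0 :=
  single_ne_zero one_ne_zero

theorem dInf_mul (f g : LaurentSeries ℂ) : dInf (f * g) = f * dInf g + g * dInf f := by
  -- `z d/dz` multiplies the coefficient of `t ^ k` by `-k`, which makes its Leibniz rule termwise.
  have euler : zInf * dInf (f * g) = f * (zInf * dInf g) + (zInf * dInf f) * g := by
    ext k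
    rw [coeff_zInf_mul_dInf, coeff_add,
      coeff_mul_right' g.isPWO_support (support_zInf_mul_dInf_subset g),
      coeff_mul_left' f.isPWO_support (support_zInf_mul_dInf_subset f), coeff_mul,
      Finset.mul_sum, ← Finset.sum_add_distrib]
    refine Finset.sum_congr rfl fun p hp => ?_
    rw [coeff_zInf_mul_dInf, coeff_zInf_mul_dInf, ← (Finset.mem_antidiagonal.mp hp).2.2]
    push_cast
    ring
  refine mul_left_cancel₀ zInf_ne_zero (euler.trans ?_)
  ring

theorem dInf_add (f g : LaurentSeries ℂ) : dInf (f + g) = dInf f + dInf g := by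
  rw [dInf, map_add, mul_add, neg_add, dInf, dInf]

theorem dInf_zero : dInf 0 = 0 := by
  rw [dInf, map_zero, mul_zero, neg_zero]

theorem coeff_algebraMap (a : ℂ) (k : ℤ) :
    (algebraMap ℂ (LaurentSeries ℂ) a).coeff k = if k = 0 then a else 0 := by
  rw [LaurentSeries.algebraMap_apply, C_apply, coeff_single]
  congr

theorem dInf_algebraMap (a : ℂ) : dInf (algebraMap ℂ (LaurentSeries ℂ) a) = 0 := by
  ext k
  rw [coeff_dInf, coeff_algebraMap, coeff_zero, mul_ite, mul_zero]
  exact ite_eq_right_iff.mpr fun hk => by rw [hk, Int.cast_zero, neg_zero, zero_mul]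

theorem dInf_single (k : ℤ) (a : ℂ) : dInf (single k a) = single (k + 1) (-k * a) := by
  ext j
  rw [coeff_dInf, coeff_single, coeff_single]
  by_cases hj : j = k + 1
  · rw [if_pos hj, if_pos (by omega), hj, add_sub_cancel_right]
  · rw [if_neg hj, if_neg (by omega), mul_zero]

/-- The Laurent series in `t` supported on the exponents `i`, `i + M`, `i + 2 * M`, … With `M = 1`
they measure the order of vanishing at infinity, with `M = 2 * N + 1` the sparsity of expansions. -/
def gradedTail (R : Type*) [CommRing R] (M i : ℕ) : AddSubgroup (LaurentSeries R) where
  carrier := {f | ∀ k : ℤ, f.coeff k ≠ 0 → ∃ m : ℕ, k = i + M * m}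
  zero_mem' _ hk := (hk rfl).elim
  add_mem' {f g} hf hg k hk := by
    by_cases hfk : f.coeff k = 0
    · exact hg k fun hgk => hk (by rw [coeff_add, hfk, hgk, add_zero])
    · exact hf k hfk
  neg_mem' {f} hf k hk := hf k (by rwa [coeff_neg, neg_ne_zero] at hk)

variable {R : Type*} [CommRing R] {M i : ℕ}

instance : SetLike.GradedMonoid (gradedTail R M) where
  one_mem k hk := by
    obtain rfl : k = 0 := by_contra fun h => hk (by rw [coeff_one, if_neg h])
    exact ⟨0, by simp⟩
  mul_mem {i j f g} hf hg k hk := by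
    rw [coeff_mul] at hk
    obtain ⟨p, hp, hne⟩ := Finset.exists_ne_zero_of_sum_ne_zero hk
    obtain ⟨m, hm⟩ := hf _ (left_ne_zero_of_mul hne)
    obtain ⟨n, hn⟩ := hg _ (right_ne_zero_of_mul hne)
    refine ⟨m + n, ?_⟩
    rw [← (Finset.mem_antidiagonal.mp hp).2.2, hm, hn]
    push_cast
    ring

theorem dInf_mem_gradedTail {f : LaurentSeries ℂ} (hf : f ∈ gradedTail ℂ M i) :
    dInf f ∈ gradedTail ℂ M (i + 1) := by
  intro k hk
  rw [coeff_dInf] at hk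
  obtain ⟨m, hm⟩ := hf _ (right_ne_zero_of_mul hk)
  exact ⟨m, by push_cast; linear_combination hm⟩

theorem algebraMap_mem_gradedTail (a : ℂ) :
    algebraMap ℂ (LaurentSeries ℂ) a ∈ gradedTail ℂ M 0 := by
  intro k hk
  rw [coeff_algebraMap, ite_ne_right_iff] at hk
  exact ⟨0, by simpa using hk.1⟩

theorem coeff_seriesAtInfinity_add_one (c : ℕ → ℂ) (m : ℕ) :
    (seriesAtInfinity c).coeff (m + 1) = c m := by
  rw [seriesAtInfinity, coeff_single_mul, add_sub_cancel_right, one_mul,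
    ofPowerSeries_apply_coeff, PowerSeries.coeff_mk]

theorem coeff_seriesAtInfinity_of_lt_one (c : ℕ → ℂ) {k : ℤ} (hk : k < 1) :
    (seriesAtInfinity c).coeff k = 0 := by
  rw [seriesAtInfinity, coeff_single_mul, one_mul, ofPowerSeries_apply]
  refine embDomain_of_notMem_range ?_
  rintro ⟨m, hm : (m : ℤ) = k - 1⟩
  omega

theorem exists_of_coeff_seriesAtInfinity_ne_zero {c : ℕ → ℂ} {k : ℤ}
    (hk : (seriesAtInfinity c).coeff k ≠ 0) : ∃ m : ℕ, k = m + 1 ∧ c m ≠ 0 := by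
  have hk₁ : 1 ≤ k := not_lt.mp fun h => hk (coeff_seriesAtInfinity_of_lt_one c h)
  obtain ⟨m, rfl⟩ : ∃ m : ℕ, k = m + 1 := ⟨(k - 1).toNat, by omega⟩
  exact ⟨m, rfl, coeff_seriesAtInfinity_add_one c m ▸ hk⟩

theorem eq_seriesAtInfinity_iff {f : LaurentSeries ℂ} {c : ℕ → ℂ} :
    f = seriesAtInfinity c ↔ (∀ k < 1, f.coeff k = 0) ∧ ∀ m : ℕ, f.coeff (m + 1) = c m := by
  refine ⟨?_, fun ⟨hlt, hge⟩ => ?_⟩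
  · rintro rfl
    exact ⟨fun k => coeff_seriesAtInfinity_of_lt_one c, coeff_seriesAtInfinity_add_one c⟩
  · ext k
    obtain hk | hk := lt_or_ge k 1
    · rw [hlt k hk, coeff_seriesAtInfinity_of_lt_one c hk]
    · obtain ⟨m, rfl⟩ : ∃ m : ℕ, k = m + 1 := ⟨(k - 1).toNat, by omega⟩
      rw [hge, coeff_seriesAtInfinity_add_one]

theorem seriesAtInfinity_mem_gradedTail {c : ℕ → ℂ} (hc : ∀ m, ¬ M ∣ m → c m = 0) :
    seriesAtInfinity c ∈ gradedTail ℂ M 1 := by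
  intro k hk
  obtain ⟨m, rfl, hm⟩ := exists_of_coeff_seriesAtInfinity_ne_zero hk
  obtain ⟨j, rfl⟩ := not_not.mp (mt (hc m) hm)
  exact ⟨j, by push_cast; ring⟩

theorem seriesAtInfinity_add (c c' : ℕ → ℂ) :
    seriesAtInfinity c + seriesAtInfinity c' = seriesAtInfinity (c + c') := by
  rw [eq_seriesAtInfinity_iff]
  refine ⟨fun k hk => ?_, fun m => ?_⟩
  · rw [coeff_add, coeff_seriesAtInfinity_of_lt_one c hk, coeff_seriesAtInfinity_of_lt_one c' hk,
      add_zero]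
  · rw [coeff_add, coeff_seriesAtInfinity_add_one, coeff_seriesAtInfinity_add_one, Pi.add_apply]

theorem seriesAtInfinity_sub (c c' : ℕ → ℂ) :
    seriesAtInfinity c - seriesAtInfinity c' = seriesAtInfinity (c - c') := by
  rw [sub_eq_iff_eq_add, seriesAtInfinity_add, sub_add_cancel]

theorem seriesAtInfinity_zero : seriesAtInfinity 0 = 0 :=
  (eq_seriesAtInfinity_iff.mpr ⟨fun _ _ => coeff_zero, fun _ => coeff_zero⟩).symm

theorem sub_mul_seriesAtInfinity_pow (a : ℂ) :
    (zInf - algebraMap ℂ (LaurentSeries ℂ) a) * seriesAtInfinity (fun m => a ^ m) = 1 := by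
  ext k
  rw [sub_mul, coeff_sub, coeff_zInf_mul, LaurentSeries.algebraMap_apply, C_apply,
    coeff_single_mul, sub_zero, ← single_zero_one]
  obtain hk | rfl | hk := lt_trichotomy k 0
  · rw [coeff_seriesAtInfinity_of_lt_one _ (by omega),
      coeff_seriesAtInfinity_of_lt_one _ (by omega), coeff_single_of_ne hk.ne, mul_zero, sub_zero]
  · have h₀ := coeff_seriesAtInfinity_add_one (fun m => a ^ m) 0
    rw [Nat.cast_zero, pow_zero] at h₀
    rw [h₀, coeff_seriesAtInfinity_of_lt_one _ zero_lt_one, coeff_single_same, mul_zero, sub_zero]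
  · obtain ⟨m, rfl⟩ : ∃ m : ℕ, k = m + 1 := ⟨(k - 1).toNat, by omega⟩
    have hsucc := coeff_seriesAtInfinity_add_one (fun m => a ^ m) (m + 1)
    rw [Nat.cast_succ] at hsucc
    rw [hsucc, coeff_seriesAtInfinity_add_one, coeff_single_of_ne hk.ne', pow_succ', sub_self]

end Laurent

/-! ### The formal solution -/

section Causal

variable {ι R : Type*} [Preorder ι]

/-- The value of `F c` at an index depends only on the values of `c` at smaller indices, so that
`F c = c` is a recursion for `c`. -/
def IsCausal (F : (ι → R) → ι → R) : Prop :=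
  ∀ m c c', (∀ i < m, c i = c' i) → F c m = F c' m

theorem IsCausal.existsUnique_isFixedPt [WellFoundedLT ι] [Inhabited R] {F : (ι → R) → ι → R}
    (hF : IsCausal F) : ∃! c, Function.IsFixedPt F c := by
  classical
  let step (m : ι) (c : ∀ i < m, R) : R := F (fun i => if h : i < m then c i h else default) m
  have hstep : F (WellFoundedLT.fix step) = WellFoundedLT.fix step := by
    funext m
    rw [WellFoundedLT.fix_eq]
    exact hF m _ _ fun i hi => by rw [dif_pos hi]
  refine ⟨WellFoundedLT.fix step, hstep, fun c hc => funext fun m => ?_⟩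
  induction m using WellFoundedLT.induction with
  | ind m ih => rw [← hc.eq, ← hstep]; exact hF m _ _ ih

theorem IsCausal.eq_zero_of_isFixedPt [WellFoundedLT ι] [Zero R] {F : (ι → R) → ι → R}
    (hF : IsCausal F) {Z : Set ι} (hZ : ∀ c, (∀ i ∈ Z, c i = 0) → ∀ i ∈ Z, F c i = 0) {c : ι → R}
    (hc : Function.IsFixedPt F c) {m : ι} (hm : m ∈ Z) : c m = 0 := by
  induction m using WellFoundedLT.induction with
  | ind m ih =>
    -- Truncating `c` below `m` does not change `F c m`, and makes it vanish on all of `Z`.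
    have htrunc : F ((Set.Iio m).indicator c) m = 0 :=
      hZ _ (fun i hi => Set.indicator_apply_eq_zero.mpr fun him => ih i him hi) m hm
    rw [← hc.eq, ← htrunc]
    exact hF m _ _ fun i hi => (Set.indicator_of_mem (Set.mem_Iio.mpr hi) c).symm

end Causal

section Expansion

/-- Comparing coefficients of `t ^ m` turns `P₂^{(N)}[w, α] = 0` into the fixed point equation
`expansionStep N α c = c` for the coefficients `c` of `w`. -/
noncomputable def expansionStep (N : ℕ) (α : ℂ) (c : ℕ → ℂ) (m : ℕ) : ℂ :=
  (P2Nonlinear dInf N (seriesAtInfinity c)).coeff m - if m = 0 then α else 0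

variable {N : ℕ} {α : ℂ} {c : ℕ → ℂ}

theorem P2Nonlinear_seriesAtInfinity_mem {M : ℕ} (hc : ∀ m, ¬ M ∣ m → c m = 0) :
    P2Nonlinear dInf N (seriesAtInfinity c) ∈ gradedTail ℂ M (2 * N + 1) :=
  P2Nonlinear_mem_graded (gradedTail ℂ M) algebraMap_mem_gradedTail
    (fun _ _ => dInf_mem_gradedTail) N (seriesAtInfinity_mem_gradedTail hc)

theorem coeff_P2Nonlinear_seriesAtInfinity_of_lt (N : ℕ) (c : ℕ → ℂ) {k : ℤ} (hk : k < 2 * N + 1) :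
    (P2Nonlinear dInf N (seriesAtInfinity c)).coeff k = 0 := by
  by_contra h
  obtain ⟨m, rfl⟩ := P2Nonlinear_seriesAtInfinity_mem (M := 1)
    (fun m hm => (hm (one_dvd m)).elim) k h
  push_cast at hk
  omega

theorem coeff_P2_seriesAtInfinity (N : ℕ) (α : ℂ) (c : ℕ → ℂ) (k : ℤ) :
    (P2 dInf zInf N (seriesAtInfinity c) α).coeff k =
      (P2Nonlinear dInf N (seriesAtInfinity c)).coeff k - (seriesAtInfinity c).coeff (k + 1)
        - if k = 0 then α else 0 := by
  rw [P2_eq_P2Nonlinear_sub, HahnSeries.coeff_sub, HahnSeries.coeff_sub, coeff_zInf_mul,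
    coeff_algebraMap]

theorem isExpansionAtInfinity_iff_isFixedPt :
    IsExpansionAtInfinity N α c ↔ Function.IsFixedPt (expansionStep N α) c := by
  have hcoeff (m : ℕ) : (P2 dInf zInf N (seriesAtInfinity c) α).coeff m =
      expansionStep N α c m - c m := by
    rw [coeff_P2_seriesAtInfinity, coeff_seriesAtInfinity_add_one, expansionStep]
    simp only [Nat.cast_eq_zero]
    ring
  constructor
  · intro hc
    funext m
    rw [← sub_eq_zero, ← hcoeff, show P2 dInf zInf N (seriesAtInfinity c) α = 0 from hc,
      HahnSeries.coeff_zero]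
  · intro hc
    ext k
    rw [HahnSeries.coeff_zero]
    obtain hk | hk := lt_or_ge k 0
    · rw [coeff_P2_seriesAtInfinity, coeff_P2Nonlinear_seriesAtInfinity_of_lt N c (by omega),
        coeff_seriesAtInfinity_of_lt_one c (by omega), if_neg hk.ne, sub_zero, sub_zero]
    · lift k to ℕ using hk
      rw [hcoeff, hc.eq, sub_self]

theorem isCausal_expansionStep (N : ℕ) (α : ℂ) : IsCausal (expansionStep N α) := by
  intro m c c' h
  have hmem (c : ℕ → ℂ) : seriesAtInfinity c ∈ gradedTail ℂ 1 1 :=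
    seriesAtInfinity_mem_gradedTail fun m hm => (hm (one_dvd m)).elim
  have hsub : seriesAtInfinity c - seriesAtInfinity c' ∈ gradedTail ℂ 1 (1 + m) := by
    intro k hk
    rw [seriesAtInfinity_sub] at hk
    obtain ⟨j, rfl, hj⟩ := exists_of_coeff_seriesAtInfinity_ne_zero hk
    have hmj : m ≤ j := not_lt.mp fun hjm => hj (sub_eq_zero_of_eq (h j hjm))
    exact ⟨j - m, by push_cast; omega⟩
  have hP := P2Nonlinear_sub_mem (gradedTail ℂ 1) algebraMap_mem_gradedTail
    (D := AddMonoidHom.mk' dInf dInf_add) (fun _ _ => dInf_mem_gradedTail) N m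
    (hmem c) (hmem c') hsub
  rw [expansionStep, expansionStep, sub_left_inj, ← sub_eq_zero, ← HahnSeries.coeff_sub]
  by_contra hne
  obtain ⟨j, hj⟩ := hP m hne
  push_cast at hj
  omega

theorem existsUnique_isExpansionAtInfinity (N : ℕ) (α : ℂ) :
    ∃! c, IsExpansionAtInfinity N α c := by
  simpa only [isExpansionAtInfinity_iff_isFixedPt] using
    (isCausal_expansionStep N α).existsUnique_isFixedPt

namespace IsExpansionAtInfinity

theorem unique {c' : ℕ → ℂ} (hc : IsExpansionAtInfinity N α c)
    (hc' : IsExpansionAtInfinity N α c') : c = c' :=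
  (existsUnique_isExpansionAtInfinity N α).unique hc hc'

theorem apply_zero (hc : IsExpansionAtInfinity N α c) : c 0 = -α := by
  rw [← (isExpansionAtInfinity_iff_isFixedPt.mp hc).eq, expansionStep,
    coeff_P2Nonlinear_seriesAtInfinity_of_lt N c (by push_cast; omega), if_pos rfl, zero_sub]

theorem eq_zero_of_not_dvd (hc : IsExpansionAtInfinity N α c) {m : ℕ} (hm : ¬ (2 * N + 1) ∣ m) :
    c m = 0 := by
  refine (isCausal_expansionStep N α).eq_zero_of_isFixedPt (Z := {m | ¬ (2 * N + 1) ∣ m}) ?_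
    (isExpansionAtInfinity_iff_isFixedPt.mp hc) hm
  intro c hc i (hi : ¬ (2 * N + 1) ∣ i)
  have hi₀ : i ≠ 0 := fun h => hi (h ▸ dvd_zero _)
  rw [expansionStep, if_neg hi₀, sub_zero]
  by_contra hne
  obtain ⟨j, hj⟩ := P2Nonlinear_seriesAtInfinity_mem hc i hne
  exact hi ⟨1 + j, by rw [mul_one_add]; exact_mod_cast hj⟩

end IsExpansionAtInfinity

theorem isExpansionAtInfinity_one (hN : 1 ≤ N) : IsExpansionAtInfinity N 1 (Pi.single 0 (-1)) := by
  have hw : seriesAtInfinity (Pi.single 0 (-1)) = HahnSeries.single 1 (-1) := by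
    refine (eq_seriesAtInfinity_iff.mpr ⟨fun k hk => ?_, fun m => ?_⟩).symm
    · exact HahnSeries.coeff_single_of_ne hk.ne
    · simp [HahnSeries.coeff_single, Pi.single_apply, apply_ite]
  have hdw : dInf (HahnSeries.single 1 (-1)) = HahnSeries.single 1 (-1) ^ 2 := by
    rw [dInf_single, sq, HahnSeries.single_mul_single]
    norm_num
  rw [IsExpansionAtInfinity, hw, P2_eq_P2Nonlinear_sub,
    P2Nonlinear_eq_zero dInf_zero hN hdw, zInf, HahnSeries.single_mul_single]
  simp

end Expansion

/-! ### Rational functions at infinity -/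

section RationalFunctions

open Polynomial

theorem zInf_pow (n : ℕ) : zInf ^ n = HahnSeries.single (-n : ℤ) 1 := by
  rw [zInf, HahnSeries.single_pow, one_pow, smul_neg, nsmul_one]

theorem coeff_aeval_zInf (p : ℂ[X]) (k : ℕ) : (aeval zInf p).coeff (-k : ℤ) = p.coeff k := by
  induction p using Polynomial.induction_on' with
  | add p q hp hq => rw [map_add, HahnSeries.coeff_add, hp, hq, coeff_add]
  | monomial n a =>
    rw [aeval_monomial, LaurentSeries.algebraMap_apply, zInf_pow, HahnSeries.C_apply,
      HahnSeries.single_mul_single, zero_add, mul_one, coeff_monomial, HahnSeries.coeff_single]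
    simp only [neg_inj, Nat.cast_inj, eq_comm]

theorem aeval_zInf_injective : Function.Injective (aeval zInf : ℂ[X] →ₐ[ℂ] LaurentSeries ℂ) := by
  intro p q h
  ext k
  rw [← coeff_aeval_zInf, h, coeff_aeval_zInf]

theorem aeval_zInf_ne_zero {p : ℂ[X]} (hp : p ≠ 0) : aeval zInf p ≠ 0 :=
  (map_ne_zero_iff _ aeval_zInf_injective).mpr hp

/-- The expansion of a rational function at `z = ∞`, as a Laurent series in `t = 1/z`. -/
noncomputable def expandAtInfinity : RatFunc ℂ →ₐ[ℂ] LaurentSeries ℂ :=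
  RatFunc.liftAlgHom (aeval zInf)
    (nonZeroDivisors_le_comap_nonZeroDivisors_of_injective _ aeval_zInf_injective)

theorem expandAtInfinity_div (p q : ℂ[X]) :
    expandAtInfinity (algebraMap ℂ[X] (RatFunc ℂ) p / algebraMap ℂ[X] (RatFunc ℂ) q) =
      aeval zInf p / aeval zInf q :=
  RatFunc.liftAlgHom_apply_div _ _ p q

theorem expandAtInfinity_X : expandAtInfinity RatFunc.X = zInf := by
  simpa only [map_one, div_one, RatFunc.algebraMap_X, aeval_X] using expandAtInfinity_div X 1

theorem dInf_zInf : dInf zInf = 1 := by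
  rw [zInf, dInf_single, neg_add_cancel, Int.cast_neg, Int.cast_one, neg_neg, one_mul,
    HahnSeries.single_zero_one]

theorem dInf_aeval_zInf (p : ℂ[X]) : dInf (aeval zInf p) = aeval zInf (derivative p) := by
  induction p using Polynomial.induction_on with
  | C a => rw [aeval_C, dInf_algebraMap, derivative_C, map_zero]
  | add p q hp hq => rw [map_add, dInf_add, hp, hq, derivative_add, map_add]
  | monomial n a ih =>
    rw [pow_succ, ← mul_assoc, derivative_mul (f := C a * X ^ n), derivative_X, mul_one, map_add,
      map_mul, map_mul _ (derivative _), dInf_mul, ih, aeval_X, dInf_zInf]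
    ring

theorem dInf_div (f : LaurentSeries ℂ) {g : LaurentSeries ℂ} (hg : g ≠ 0) :
    dInf (f / g) = (dInf f * g - f * dInf g) / g ^ 2 := by
  have hmul : dInf f = f / g * dInf g + g * dInf (f / g) := by
    rw [← dInf_mul, div_mul_cancel₀ f hg]
  rw [hmul]
  field_simp
  ring

theorem semiconj_expandAtInfinity : Function.Semiconj expandAtInfinity ratDeriv dInf := by
  intro f
  have hf : expandAtInfinity f = aeval zInf f.num / aeval zInf f.denom := by
    rw [← expandAtInfinity_div, RatFunc.num_div_denom]
  rw [ratDeriv, expandAtInfinity_div, hf, dInf_div _ (aeval_zInf_ne_zero f.denom_ne_zero),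
    dInf_aeval_zInf, dInf_aeval_zInf, map_sub, map_mul, map_mul, map_pow]

/-- The sum of the `m`-th powers of the elements of a multiset, with multiplicity. Applied to the
roots of `Q_n^{(N)}` it is the number `s_{n, m}` of Newton's identities. -/
def powerSum {R : Type*} [CommSemiring R] (s : Multiset R) (m : ℕ) : R :=
  (s.map (· ^ m)).sum

theorem aeval_zInf_derivative_prod_div (s : Multiset ℂ) :
    aeval zInf (derivative (s.map (X - C ·)).prod) / aeval zInf (s.map (X - C ·)).prod =
      seriesAtInfinity (powerSum s) := by
  induction s using Multiset.induction_on with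
  | empty =>
    rw [Multiset.map_zero, Multiset.prod_zero, derivative_one, map_zero, zero_div]
    exact seriesAtInfinity_zero.symm
  | cons a s ih =>
    have hpow : powerSum (a ::ₘ s) = (fun m => a ^ m) + powerSum s :=
      funext fun m => by simp only [powerSum, Multiset.map_cons, Multiset.sum_cons, Pi.add_apply]
    have hs : aeval zInf (s.map (X - C ·)).prod ≠ 0 :=
      aeval_zInf_ne_zero (monic_multisetProd_X_sub_C s).ne_zero
    have hpole := sub_mul_seriesAtInfinity_pow a
    have ha : zInf - algebraMap ℂ (LaurentSeries ℂ) a ≠ 0 := left_ne_zero_of_mul_eq_one hpole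
    rw [hpow, ← seriesAtInfinity_add, ← ih, eq_one_div_of_mul_eq_one_right hpole,
      Multiset.map_cons, Multiset.prod_cons, derivative_mul, derivative_X_sub_C, one_mul]
    simp only [map_add, map_mul, map_sub, aeval_X, aeval_C]
    field_simp

theorem expandAtInfinity_polyLogDeriv {Q : ℂ[X]} (hQ : Q.Monic) :
    expandAtInfinity (polyLogDeriv Q) = seriesAtInfinity (powerSum Q.roots) := by
  rw [polyLogDeriv, expandAtInfinity_div, ← aeval_zInf_derivative_prod_div,
    ← (IsAlgClosed.splits Q).eq_prod_roots_of_monic hQ]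

theorem isExpansionAtInfinity_of_isRationalSolution {N : ℕ} {α : ℂ} {P Q : ℂ[X]} (hP : P.Monic)
    (hQ : Q.Monic) (h : IsRationalSolution N α (polyLogDeriv P - polyLogDeriv Q)) :
    IsExpansionAtInfinity N α (powerSum P.roots - powerSum Q.roots) := by
  rw [IsExpansionAtInfinity, ← seriesAtInfinity_sub, ← expandAtInfinity_polyLogDeriv hP,
    ← expandAtInfinity_polyLogDeriv hQ, ← map_sub, ← expandAtInfinity_X,
    ← map_P2 expandAtInfinity semiconj_expandAtInfinity,
    show P2 ratDeriv RatFunc.X N (polyLogDeriv P - polyLogDeriv Q) α = 0 from h, map_zero]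

end RationalFunctions

/-! ### Newton's identities -/

section Newton

open Polynomial

variable {R : Type*} [CommRing R]

theorem sum_antidiagonal_filter_lt {M : Type*} [AddCommMonoid M] (f : ℕ → ℕ → M) (m : ℕ) :
    ∑ a ∈ Finset.HasAntidiagonal.antidiagonal m with a.1 < m, f a.1 a.2 =
      ∑ j ∈ Finset.Icc 1 m, f (m - j) j := by
  refine Finset.sum_nbij' Prod.snd (fun j => (m - j, j)) ?_ ?_ ?_ ?_ ?_
  all_goals
    simp only [Finset.mem_filter, Finset.HasAntidiagonal.mem_antidiagonal, Finset.mem_Icc]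
  · omega
  · omega
  · rintro ⟨i, j⟩ ⟨rfl, -⟩
    rw [Nat.add_sub_cancel]
  · exact fun _ _ => trivial
  · rintro ⟨i, j⟩ ⟨rfl, -⟩
    rw [Nat.add_sub_cancel]

theorem mul_esymm_add_sum_powerSum_mul_esymm (s : Multiset R) (m : ℕ) :
    m * ((-1) ^ m * s.esymm m) +
      ∑ j ∈ Finset.Icc 1 m, powerSum s j * ((-1) ^ (m - j) * s.esymm (m - j)) = 0 := by
  obtain ⟨d, f, hf⟩ : ∃ (d : ℕ) (f : Fin d → R), Finset.univ.val.map f = s :=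
    ⟨_, s.toList.get, by rw [Fin.univ_val_map, List.ofFn_get, Multiset.coe_toList]⟩
  have hpsum (k : ℕ) : MvPolynomial.aeval f (MvPolynomial.psum (Fin d) R k) = powerSum s k := by
    rw [powerSum, ← hf, Multiset.map_map, MvPolynomial.psum, map_sum]
    simp only [map_pow, MvPolynomial.aeval_X, Finset.sum, Function.comp_apply]
  have hnewton := congrArg (MvPolynomial.aeval f) (MvPolynomial.mul_esymm_eq_sum (Fin d) R m)
  simp only [map_mul, map_sum, map_pow, map_neg, map_one, map_natCast,
    MvPolynomial.aeval_esymm_eq_multiset_esymm, hpsum, hf] at hnewton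
  rw [sum_antidiagonal_filter_lt fun i j => (-1) ^ i * s.esymm i * powerSum s j] at hnewton
  have hsign : (-1 : R) ^ m * (-1) ^ m = 1 := by rw [← mul_pow, neg_one_mul, neg_neg, one_pow]
  simp only [mul_comm (powerSum s _)]
  linear_combination (-1) ^ m * hnewton -
    (∑ j ∈ Finset.Icc 1 m, (-1) ^ (m - j) * s.esymm (m - j) * powerSum s j) * hsign

/-- `A 0, …, A d` solve Newton's identities for the power sums `s`. -/
def IsNewtonSolution (s : ℕ → R) (d : ℕ) (A : ℕ → R) : Prop :=
  A 0 = 1 ∧ ∀ m ∈ Finset.Icc 1 d, m * A m + ∑ j ∈ Finset.Icc 1 m, s j * A (m - j) = 0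

theorem isNewtonSolution_congr {s s' A A' : ℕ → R} {d : ℕ} (hs : ∀ j, 1 ≤ j → s j = s' j)
    (hA : ∀ m ≤ d, A m = A' m) : IsNewtonSolution s d A ↔ IsNewtonSolution s' d A' := by
  refine and_congr (by rw [hA 0 d.zero_le]) (forall₂_congr fun m hm => ?_)
  have hmd := (Finset.mem_Icc.mp hm).2
  rw [hA m hmd, Finset.sum_congr rfl fun j hj => ?_]
  rw [hs j (Finset.mem_Icc.mp hj).1, hA (m - j) (by omega)]

theorem natDegree_eq_powerSum_roots_zero [IsDomain R] {Q : R[X]} (hsplit : Q.Splits) :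
    (Q.natDegree : R) = powerSum Q.roots 0 := by
  simp only [powerSum, pow_zero, Multiset.map_const', Multiset.sum_replicate, nsmul_one,
    hsplit.natDegree_eq_card_roots]

theorem isNewtonSolution_coeff [IsDomain R] {Q : R[X]} (hQ : Q.Monic) (hsplit : Q.Splits) :
    IsNewtonSolution (powerSum Q.roots) Q.natDegree fun m => Q.coeff (Q.natDegree - m) := by
  have hvieta (m : ℕ) (hm : m ≤ Q.natDegree) :
      Q.coeff (Q.natDegree - m) = (-1) ^ m * Q.roots.esymm m := by
    rw [coeff_eq_esymm_roots_of_card hsplit.natDegree_eq_card_roots.symm (Nat.sub_le _ _),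
      hQ.leadingCoeff, one_mul, Nat.sub_sub_self hm]
  refine (isNewtonSolution_congr (fun _ _ => rfl) hvieta).mpr ⟨?_, fun m _ => ?_⟩
  · simp only [pow_zero, one_mul, Multiset.esymm, Multiset.powersetCard_zero_left,
      Multiset.map_singleton, Multiset.prod_zero, Multiset.sum_singleton]
  · exact mul_esymm_add_sum_powerSum_mul_esymm Q.roots m

namespace IsNewtonSolution

variable [NoZeroDivisors R] [CharZero R] {s A A' : ℕ → R} {d m : ℕ}

theorem apply_eq (hA : IsNewtonSolution s d A) (hA' : IsNewtonSolution s d A') (hm : m ≤ d) :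
    A m = A' m := by
  induction m using Nat.strong_induction_on with
  | _ m ih =>
    obtain rfl | hpos := m.eq_zero_or_pos
    · rw [hA.1, hA'.1]
    have hsum : ∑ j ∈ Finset.Icc 1 m, s j * A (m - j) = ∑ j ∈ Finset.Icc 1 m, s j * A' (m - j) :=
      Finset.sum_congr rfl fun j hj => by
        rw [Finset.mem_Icc] at hj
        rw [ih (m - j) (by omega) (by omega)]
    have hmem := Finset.mem_Icc.mpr ⟨hpos, hm⟩
    refine mul_left_cancel₀ (Nat.cast_ne_zero.mpr hpos.ne' : (m : R) ≠ 0) ?_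
    linear_combination hA.2 m hmem - hA'.2 m hmem - hsum

theorem eq_zero_of_not_dvd (hA : IsNewtonSolution s d A) {M : ℕ} (hs : ∀ j, ¬ M ∣ j → s j = 0)
    (hm : m ≤ d) (hM : ¬ M ∣ m) : A m = 0 := by
  induction m using Nat.strong_induction_on with
  | _ m ih =>
    have hpos : 0 < m := Nat.pos_of_ne_zero fun h => hM (h ▸ dvd_zero M)
    have hnewton := hA.2 m (Finset.mem_Icc.mpr ⟨hpos, hm⟩)
    rw [Finset.sum_eq_zero, add_zero] at hnewton
    · exact (mul_eq_zero.mp hnewton).resolve_left (Nat.cast_ne_zero.mpr hpos.ne')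
    intro j hj
    rw [Finset.mem_Icc] at hj
    by_cases hMj : M ∣ j
    · have hMmj : ¬ M ∣ m - j := mt (Nat.dvd_sub_iff_left hj.2 hMj).mp hM
      rw [ih (m - j) (by omega) (by omega) hMmj, mul_zero]
    · rw [hs j hMj, zero_mul]

end IsNewtonSolution

section PowerSumRoots

variable [IsDomain R] [CharZero R] {P Q : R[X]}

theorem isNewtonSolution_powerSum_roots_iff (hQ : Q.Monic) (hsplit : Q.Splits) {A : ℕ → R} :
    IsNewtonSolution (powerSum Q.roots) Q.natDegree A ↔
      ∀ m ≤ Q.natDegree, A m = Q.coeff (Q.natDegree - m) :=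
  ⟨fun hA _ => hA.apply_eq (isNewtonSolution_coeff hQ hsplit), fun hA =>
    (isNewtonSolution_congr (fun _ _ => rfl) hA).mpr (isNewtonSolution_coeff hQ hsplit)⟩

theorem eq_of_powerSum_roots_eq (hP : P.Monic) (hP' : P.Splits) (hQ : Q.Monic) (hQ' : Q.Splits)
    (h : powerSum P.roots = powerSum Q.roots) : P = Q := by
  have hd : P.natDegree = Q.natDegree := by
    rw [← Nat.cast_inj (R := R), natDegree_eq_powerSum_roots_zero hP',
      natDegree_eq_powerSum_roots_zero hQ', h]
  have hcoeff := (isNewtonSolution_powerSum_roots_iff hQ hQ').mp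
    (hd ▸ h ▸ isNewtonSolution_coeff hP hP')
  refine ext_iff_natDegree_le hd.le le_rfl |>.mpr fun k hk => ?_
  simpa only [hd, Nat.sub_sub_self hk] using hcoeff (Q.natDegree - k) (Nat.sub_le _ _)

end PowerSumRoots

theorem exists_eq_comp_X_pow {R : Type*} [CommSemiring R] {p : R[X]} {M : ℕ} (hM : 0 < M)
    (h : ∀ k, p.coeff k ≠ 0 → M ∣ k) : ∃ q : R[X], p = q.comp (X ^ M) := by
  refine ⟨contract M p, ?_⟩
  ext k
  rw [← expand_eq_comp_X_pow, coeff_expand hM]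
  split_ifs with hk
  · rw [coeff_contract hM.ne', Nat.div_mul_cancel hk]
  · exact not_not.mp (mt (h k) hk)

theorem exists_eq_X_pow_mul_comp_X_pow {R : Type*} [CommSemiring R] {p : R[X]} {M r : ℕ}
    (hr : r < M) (h : ∀ k, p.coeff k ≠ 0 → k % M = r) :
    ∃ q : R[X], p = X ^ r * q.comp (X ^ M) ∧ q.natDegree = p.natDegree / M := by
  nontriviality R
  have hM : 0 < M := r.zero_le.trans_lt hr
  obtain ⟨g, rfl⟩ : X ^ r ∣ p := X_pow_dvd_iff.mpr fun k hk => not_not.mp fun hne =>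
    hk.ne (Nat.mod_eq_of_lt (hk.trans hr) ▸ h k hne)
  have hg (k : ℕ) (hk : g.coeff k ≠ 0) : M ∣ k := by
    have hmod : k + r ≡ 0 + r [MOD M] := by
      rw [zero_add, Nat.ModEq, Nat.mod_eq_of_lt hr]
      exact h (k + r) (by rwa [coeff_X_pow_mul])
    exact Nat.modEq_zero_iff_dvd.mp (Nat.ModEq.add_right_cancel' r hmod)
  obtain ⟨q, rfl⟩ := exists_eq_comp_X_pow hM hg
  refine ⟨q, rfl, ?_⟩
  obtain rfl | hq := eq_or_ne q 0
  · rw [zero_comp, mul_zero, natDegree_zero, Nat.zero_div]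
  rw [← expand_eq_comp_X_pow, natDegree_X_pow_mul _ ((expand_ne_zero hM).mpr hq), natDegree_expand,
    add_comm, Nat.add_mul_div_right _ _ hM, Nat.div_eq_of_lt hr, zero_add]

end Newton

/-! ### Yablonskii–Vorob'ev polynomials -/

theorem sum_Icc_one_id (n : ℕ) : ∑ i ∈ Finset.Icc 1 n, i = n * (n + 1) / 2 := by
  rw [Finset.sum_subset (Finset.Icc_subset_Icc_left zero_le_one) fun i hi hi' => by
      rw [Finset.mem_Icc] at hi hi'; omega,
    ← Nat.range_succ_eq_Icc_zero, Finset.sum_range_id, Nat.add_sub_cancel, mul_comm]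

namespace IsYablonskiiVorobev

open Polynomial

variable {N n : ℕ} {Q Q' : ℂ[X]} {c : ℕ → ℕ → ℂ}

theorem monic (hQ : IsYablonskiiVorobev N n Q) : Q.Monic := by
  cases hQ with
  | zero => exact monic_one
  | succ _ hQ _ => exact hQ

theorem powerSum_roots (hQ : IsYablonskiiVorobev N n Q)
    (hc : ∀ i : ℕ, IsExpansionAtInfinity N i (c i)) (m : ℕ) :
    powerSum Q.roots m = -∑ i ∈ Finset.Icc 1 n, c i m := by
  induction hQ with
  | zero => simp [powerSum]
  | @succ n P Q hP hQ hsol ih =>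
    have hstep : c (n + 1) = powerSum P.roots - powerSum Q.roots :=
      (hc (n + 1)).unique (isExpansionAtInfinity_of_isRationalSolution hP.monic hQ hsol)
    rw [Finset.sum_Icc_succ_top (Nat.le_add_left 1 n), hstep, Pi.sub_apply, ih]
    ring

theorem unique (hQ : IsYablonskiiVorobev N n Q) (hQ' : IsYablonskiiVorobev N n Q') : Q = Q' := by
  choose c hc _ using fun i : ℕ => existsUnique_isExpansionAtInfinity N i
  refine eq_of_powerSum_roots_eq hQ.monic (IsAlgClosed.splits Q) hQ'.monic (IsAlgClosed.splits Q')
    (funext fun m => ?_)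
  rw [hQ.powerSum_roots hc, hQ'.powerSum_roots hc]

theorem natDegree_eq_neg_sum (hQ : IsYablonskiiVorobev N n Q)
    (hc : ∀ i : ℕ, IsExpansionAtInfinity N i (c i)) :
    (Q.natDegree : ℂ) = -∑ i ∈ Finset.Icc 1 n, c i 0 := by
  rw [natDegree_eq_powerSum_roots_zero (IsAlgClosed.splits Q), hQ.powerSum_roots hc]

theorem natDegree_eq (hQ : IsYablonskiiVorobev N n Q) : Q.natDegree = n * (n + 1) / 2 := by
  choose c hc _ using fun i : ℕ => existsUnique_isExpansionAtInfinity N i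
  have hsum : Q.natDegree = ∑ i ∈ Finset.Icc 1 n, i := by
    have h := hQ.natDegree_eq_neg_sum hc
    simp only [fun i => (hc i).apply_zero, Finset.sum_neg_distrib, neg_neg] at h
    exact Nat.cast_injective (h.trans (Nat.cast_sum _ _).symm)
  rw [hsum, sum_Icc_one_id]

theorem powerSum_roots_of_pos (hQ : IsYablonskiiVorobev N n Q) (hN : 1 ≤ N)
    (hc : ∀ i : ℕ, IsExpansionAtInfinity N i (c i)) {m : ℕ} (hm : 1 ≤ m) :
    powerSum Q.roots m = -∑ i ∈ Finset.Icc 2 n, c i m := by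
  have hc₁ : c 1 m = 0 := by
    rw [(hc 1).unique (Nat.cast_one (R := ℂ) ▸ isExpansionAtInfinity_one hN)]
    exact Pi.single_eq_of_ne (Nat.one_le_iff_ne_zero.mp hm) _
  rw [hQ.powerSum_roots hc, neg_inj]
  refine (Finset.sum_subset (Finset.Icc_subset_Icc_left one_le_two) fun i hi hi' => ?_).symm
  obtain rfl : i = 1 := by rw [Finset.mem_Icc] at hi hi'; omega
  exact hc₁

theorem isNewtonSolution_iff (hQ : IsYablonskiiVorobev N n Q) (hN : 1 ≤ N)
    (hc : ∀ i : ℕ, IsExpansionAtInfinity N i (c i)) (A : ℕ → ℂ) :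
    IsNewtonSolution (fun j => -∑ i ∈ Finset.Icc 2 n, c i j) (n * (n + 1) / 2) A ↔
      ∀ m ≤ n * (n + 1) / 2, A m = Q.coeff (n * (n + 1) / 2 - m) := by
  rw [← hQ.natDegree_eq, ← isNewtonSolution_powerSum_roots_iff hQ.monic (IsAlgClosed.splits Q)]
  exact isNewtonSolution_congr (fun j hj => (hQ.powerSum_roots_of_pos hN hc hj).symm)
    fun _ _ => rfl

theorem powerSum_roots_eq_zero_of_not_dvd (hQ : IsYablonskiiVorobev N n Q) {m : ℕ}
    (hm : ¬ (2 * N + 1) ∣ m) : powerSum Q.roots m = 0 := by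
  choose c hc _ using fun i : ℕ => existsUnique_isExpansionAtInfinity N i
  rw [hQ.powerSum_roots hc, Finset.sum_eq_zero fun i _ => (hc i).eq_zero_of_not_dvd hm, neg_zero]

theorem coeff_eq_zero_of_not_dvd (hQ : IsYablonskiiVorobev N n Q) {m : ℕ}
    (hm : m ≤ n * (n + 1) / 2) (hdvd : ¬ (2 * N + 1) ∣ m) :
    Q.coeff (n * (n + 1) / 2 - m) = 0 := by
  rw [← hQ.natDegree_eq] at hm ⊢
  exact (isNewtonSolution_coeff hQ.monic (IsAlgClosed.splits Q)).eq_zero_of_not_dvd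
    (fun _ => hQ.powerSum_roots_eq_zero_of_not_dvd) hm hdvd

theorem exists_eq_X_pow_mul_comp (hQ : IsYablonskiiVorobev N n Q) :
    ∃ q : ℂ[X], Q = X ^ (n * (n + 1) / 2 % (2 * N + 1)) * q.comp (X ^ (2 * N + 1)) ∧
      q.natDegree = n * (n + 1) / (4 * N + 2) := by
  have hdiv : n * (n + 1) / (4 * N + 2) = Q.natDegree / (2 * N + 1) := by
    rw [hQ.natDegree_eq, Nat.div_div_eq_div_mul, show 2 * (2 * N + 1) = 4 * N + 2 by ring]
  rw [hdiv]
  refine exists_eq_X_pow_mul_comp_X_pow (Nat.mod_lt _ (Nat.succ_pos _)) fun k hk => ?_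
  have hkd : k ≤ n * (n + 1) / 2 := hQ.natDegree_eq ▸ le_natDegree_of_ne_zero hk
  refine (Nat.modEq_iff_dvd' hkd).mpr (not_not.mp fun hdvd => hk ?_)
  rw [← hQ.coeff_eq_zero_of_not_dvd (Nat.sub_le _ k) hdvd, Nat.sub_sub_self hkd]

end IsYablonskiiVorobev

theorem dvd_mul_add_one_div_two {M n : ℕ} (hM : Odd M) (h : M ∣ n ∨ M ∣ n + 1) :
    M ∣ n * (n + 1) / 2 := by
  refine (Nat.coprime_two_right.mpr hM).dvd_of_dvd_mul_right ?_
  rw [Nat.div_mul_cancel (Nat.even_mul_succ_self n).two_dvd]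
  exact h.elim (Dvd.dvd.mul_right · _) (Dvd.dvd.mul_left · _)

end PainleveTwo

theorem theorem3 (N : ℕ) (hN : 1 ≤ N) :
    (∀ α : ℂ, ∃ c : ℕ → ℂ, PainleveTwo.IsExpansionAtInfinity N α c ∧
      (∀ c' : ℕ → ℂ, PainleveTwo.IsExpansionAtInfinity N α c' → c' = c) ∧
      c 0 = -α ∧ ∀ m : ℕ, ¬ (2 * N + 1) ∣ m → c m = 0) ∧
    ∀ c : ℕ → ℕ → ℂ, (∀ i : ℕ, PainleveTwo.IsExpansionAtInfinity N (i : ℂ) (c i)) →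
    ∀ (n : ℕ) (Q : Polynomial ℂ), PainleveTwo.IsYablonskiiVorobev N n Q →
      (∀ Q' : Polynomial ℂ, PainleveTwo.IsYablonskiiVorobev N n Q' → Q' = Q) ∧
      Q.Monic ∧
      Q.natDegree = n * (n + 1) / 2 ∧
      (Q.natDegree : ℂ) = -∑ i ∈ Finset.Icc 1 n, c i 0 ∧
      (∀ m : ℕ, 1 ≤ m → (Q.roots.map (fun a => a ^ m)).sum = -∑ i ∈ Finset.Icc 2 n, c i m) ∧
      (∀ A : ℕ → ℂ,
        (A 0 = 1 ∧ ∀ m ∈ Finset.Icc 1 (n * (n + 1) / 2),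
          (m : ℂ) * A m +
            ∑ j ∈ Finset.Icc 1 m, (-∑ i ∈ Finset.Icc 2 n, c i j) * A (m - j) = 0) ↔
        ∀ m ≤ n * (n + 1) / 2, A m = Q.coeff (n * (n + 1) / 2 - m)) ∧
      (∀ m ≤ n * (n + 1) / 2, ¬ (2 * N + 1) ∣ m → Q.coeff (n * (n + 1) / 2 - m) = 0) ∧
      (∃ q : Polynomial ℂ,
        Q = Polynomial.X ^ (n * (n + 1) / 2 % (2 * N + 1)) * q.comp (Polynomial.X ^ (2 * N + 1)) ∧
        q.natDegree = n * (n + 1) / (4 * N + 2)) ∧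
      (n % (2 * N + 1) = 0 ∨ n % (2 * N + 1) = 2 * N → (2 * N + 1) ∣ n * (n + 1) / 2) := by
  constructor
  · intro α
    obtain ⟨c, hc, hunique⟩ := PainleveTwo.existsUnique_isExpansionAtInfinity N α
    exact ⟨c, hc, hunique, hc.apply_zero, fun _ => hc.eq_zero_of_not_dvd⟩
  · intro c hc n Q hQ
    refine ⟨fun Q' hQ' => hQ'.unique hQ, hQ.monic, hQ.natDegree_eq, hQ.natDegree_eq_neg_sum hc,
      fun _ => hQ.powerSum_roots_of_pos hN hc, hQ.isNewtonSolution_iff hN hc,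
      fun _ => hQ.coeff_eq_zero_of_not_dvd, hQ.exists_eq_X_pow_mul_comp, fun hn => ?_⟩
    refine PainleveTwo.dvd_mul_add_one_div_two (odd_two_mul_add_one N) (hn.imp ?_ fun h => ?_)
    · exact Nat.dvd_of_mod_eq_zero
    · rw [← Nat.div_add_mod n (2 * N + 1), h, add_assoc]
      exact dvd_add (dvd_mul_right _ _) dvd_rfl
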